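/- For a finite graph $\Gamma$ with vertex set $V$, let $B(\Gamma)$ be the set of all nonempty $I\subseteq V$ such that the induced subgraph $\Gamma|_I$ is connected, and let $P(\Gamma)=\sum_{S\in B(\Gamma)}\operatorname{conv}\{e_i : i\in S\}\subset\mathbb R^V$ (Minkowski sum) be the graphical nestohedron of $\Gamma$, where $(e_i)_{i\in V}$ is the standard basis of $\mathbb R^V$. For an $n$-dimensional polytope $P$ let $f(P)(\alpha,t)=\sum_{i=0}^{n} f_i(P)\,\alpha^{i}t^{n-i}\in\mathbb Q[\alpha,t]$, where $f_i(P)$ is the number of $i$-dimensional faces of $P$ (so $f_n(P)=1$, and the empty face is not counted). Let $K_{k,l}$ be the complete bipartite graph with parts of sizes $k,l\ge 0$, and consider the generating function $$P_f(\alpha,t,x,y)=\sum_{\substack{k,l\ge 0\\ K_{k,l}\text{ connected}}} f\bigl(P(K_{k,l})\bigr)(\alpha,t)\,\frac{x^k}{k!}\frac{y^l}{l!}\in\mathbb Q[\alpha,t][[x,y]],$$ where the sum runs over the nonempty connected $K_{k,l}$, i.e. over $(k,l)=(1,0)$, $(k,l)=(0,1)$ and all $k,l\ge 1$. Put $\eta(z)=\dfrac{e^{\alpha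 z}-1}{\alpha}=\sum_{n\ge1}\alpha^{n-1}\dfrac{z^n}{n!}$. Then in $\mathbb Q[\alpha,t][[x,y]]$ $$P_f(\alpha,t,x,y)=\frac{1}{1-t\,\eta(x+y)}\Bigl(e^{(\alpha+t)x}\eta(y)+e^{(\alpha+t)y}\eta(x)+\alpha\,\eta(x)\eta(y)-e^{\alpha x}\eta(y)-e^{\alpha y}\eta(x)\Bigr)+(x+y).$$ -/

import Mathlib

open scoped Pointwise

namespace BipartiteNestohedra

noncomputable section

/-! ### Polytopes and their f-polynomials -/

/-- The dimension of a convex set: the dimension of its affine span. -/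
def setDim {V : Type*} (P : Set (V → ℝ)) : ℕ :=
  Module.finrank ℝ (vectorSpan ℝ P)

/-- The (nonempty) faces of a polytope `P`: the nonempty subsets of `P` on which some linear
functional attains its maximum over `P`. The polytope itself is a face (zero functional). -/
def IsFace {V : Type*} (P F : Set (V → ℝ)) : Prop :=
  F.Nonempty ∧ IsExposed ℝ P F

/-- The number of faces of dimension `i`. -/
def faceCount {V : Type*} (P : Set (V → ℝ)) (i : ℕ) : ℕ :=
  {F : Set (V → ℝ) | IsFace P F ∧ setDim F = i}.ncard

/-- The coefficient ring `ℚ[α, t]`. -/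
abbrev Coeff : Type := MvPolynomial (Fin 2) ℚ

/-- The variable `α` of `ℚ[α, t]`. -/
def varα : Coeff := MvPolynomial.X 0

/-- The variable `t` of `ℚ[α, t]`. -/
def varT : Coeff := MvPolynomial.X 1

/-- The (homogeneous) f-polynomial `∑ᵢ fᵢ αⁱ tⁿ⁻ⁱ` of an `n`-dimensional polytope, where `fᵢ` is
the number of its `i`-dimensional faces, so that `fₙ = 1`. -/
def fPolynomial {V : Type*} (P : Set (V → ℝ)) : Coeff :=
  ∑ i ∈ Finset.range (setDim P + 1), (faceCount P i : Coeff) * varα ^ i * varT ^ (setDim P - i)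

/-! ### Nestohedra -/

/-- A building set on a finite set `V`. -/
structure BuildingSet (V : Type*) [DecidableEq V] where
  sets : Finset (Finset V)
  nonempty_of_mem : ∀ S ∈ sets, S.Nonempty
  union_mem : ∀ S₁ ∈ sets, ∀ S₂ ∈ sets, (S₁ ∩ S₂).Nonempty → S₁ ∪ S₂ ∈ sets
  singleton_mem : ∀ i, {i} ∈ sets

open scoped Classical in
/-- The building set of a graph: the nonempty vertex sets inducing a connected subgraph
(`Connected` includes nonemptiness). -/
def graphicalBuildingSet {V : Type*} [Fintype V] [DecidableEq V] (Γ : SimpleGraph V) :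
    BuildingSet V where
  sets := Finset.univ.filter fun I => (Γ.induce (I : Set V)).Connected
  nonempty_of_mem := by
    intro S hS
    obtain ⟨v⟩ := (Finset.mem_filter.1 hS).2.nonempty
    exact ⟨v.1, v.2⟩
  union_mem := by
    intro S₁ h₁ S₂ h₂ h
    simp only [Finset.mem_filter, Finset.mem_univ, true_and] at h₁ h₂ ⊢
    rw [Finset.coe_union]
    exact SimpleGraph.induce_union_connected h₁.preconnected h₂.preconnected
      (by rw [← Finset.coe_inter]; exact_mod_cast h)
  singleton_mem := by
    intro i
    simp only [Finset.mem_filter, Finset.mem_univ, true_and]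
    rw [Finset.coe_singleton, SimpleGraph.induce_singleton_eq_top]
    exact SimpleGraph.connected_top

/-- The simplex `Δ_S`, the convex hull of the standard basis vectors `eᵢ`, `i ∈ S`. -/
def simplexOn {V : Type*} [DecidableEq V] (S : Finset V) : Set (V → ℝ) :=
  convexHull ℝ ((fun i : V => (Pi.single i 1 : V → ℝ)) '' (S : Set V))

/-- The nestohedron of a building set: the Minkowski sum of the simplices `Δ_S`, `S ∈ B`. -/
def nestohedron {V : Type*} [DecidableEq V] (B : BuildingSet V) : Set (V → ℝ) :=
  ∑ S ∈ B.sets, simplexOn S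

/-- The graphical nestohedron of the complete bipartite graph `K_{k,l}`. -/
def bipartiteNestohedron (k l : ℕ) : Set (Fin k ⊕ Fin l → ℝ) :=
  nestohedron (graphicalBuildingSet (completeBipartiteGraph (Fin k) (Fin l)))

/-! ### Power series in `x, y` over `ℚ[α, t]` -/

/-- The ring `ℚ[α, t][[x, y]]`. -/
abbrev Series : Type := MvPowerSeries (Fin 2) Coeff

/-- The variable `x`. -/
def varX : Series := MvPowerSeries.X 0

/-- The variable `y`. -/
def varY : Series := MvPowerSeries.X 1

/-- The constant series `α`. -/
def serα : Series := MvPowerSeries.C varα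

/-- The constant series `t`. -/
def serT : Series := MvPowerSeries.C varT

/-- The exponential `e ^ u` of a series `u` without constant term. -/
def expOf (u : Series) : Series :=
  (PowerSeries.exp Coeff).subst u

/-- The one-variable series `η(z) = (e^{αz} - 1) / α = ∑_{n ≥ 1} αⁿ⁻¹ zⁿ / n!`. -/
def etaSeries : PowerSeries Coeff :=
  PowerSeries.mk fun n =>
    if n = 0 then 0 else algebraMap ℚ Coeff (1 / (n.factorial : ℚ)) * varα ^ (n - 1)

/-- `η` is indeed `(e^{αz} - 1) / α`; this determines it, as `α` is not a zero divisor. -/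
theorem varα_mul_etaSeries :
    PowerSeries.C varα * etaSeries = PowerSeries.rescale varα (PowerSeries.exp Coeff) - 1 := by
  ext1 n
  rw [PowerSeries.coeff_C_mul, map_sub, PowerSeries.coeff_rescale, PowerSeries.coeff_exp,
    PowerSeries.coeff_one, etaSeries, PowerSeries.coeff_mk]
  rcases n with _ | n
  · simp
  · simp only [Nat.add_one_ne_zero, if_false, Nat.add_sub_cancel, sub_zero, pow_succ]
    ring

/-- `η(u)` for a series `u` without constant term. -/
def etaOf (u : Series) : Series :=
  etaSeries.subst u

/-- The series `1 / (1 - t η(x + y))`. -/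
def invOneSub : Series :=
  MvPowerSeries.invOfUnit (1 - serT * etaOf (varX + varY)) 1

theorem one_sub_mul_invOneSub : (1 - serT * etaOf (varX + varY)) * invOneSub = 1 := by
  refine MvPowerSeries.mul_invOfUnit _ _ ?_
  have h : MvPowerSeries.constantCoeff (etaOf (varX + varY)) = 0 :=
    PowerSeries.constantCoeff_subst_eq_zero (by simp [varX, varY]) _
      (by simp [etaSeries, ← PowerSeries.coeff_zero_eq_constantCoeff_apply])
  simp [h]

open scoped Classical in
/-- The generating function `∑ f(P_{k,l}) xᵏ/k! yˡ/l!` of the f-polynomials of the nestohedra of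
the complete bipartite graphs, over all `k, l ≥ 0` for which `K_{k,l}` is connected. -/
def bipartiteFSeries : Series := fun e =>
  if (completeBipartiteGraph (Fin (e 0)) (Fin (e 1))).Connected then
    algebraMap ℚ Coeff (1 / ((e 0).factorial * (e 1).factorial : ℚ)) *
      fPolynomial (bipartiteNestohedron (e 0) (e 1))
  else 0

end

end BipartiteNestohedra

/-!
A functional `w` is maximal on a Minkowski sum exactly on the sum of its maximal faces of the
summands, so a face of the nestohedron of a building set `B` is the same thing as the function
sending `S ∈ B` to the set `argmaxOn w S` of those elements of `S` where `w` is maximal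
(`isFace_nestohedron_iff`, `argmaxOn_eq_of_simplexSum_eq`). Such a function is called a type here.

For `U ∈ B`, a type on the subsets of `U` consists of the nonempty maximum locus `A ⊆ U` of `w` on
`U` and of an arbitrary type on the subsets of `U \ A`: a set `S ∈ B` that meets `A` is sent to
`S ∩ A`, and all other sets lie in `U \ A`. The dimension of the face is `|A| - 1` plus that of
the remaining type (`typeDim_consType`). Counting types with weights `α ^ dim * t ^ (|U| - dim)`
gives a sum `W(U)` with `W(U) = ∑_A α ^ (|A| - 1) * t * W(U \ A)` (`typeSum_eq_sum_powerset`),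
and `t * f(P) = W(V)` when `V ∈ B` (`varT_mul_fPolynomial_nestohedron`).

For complete bipartite graphs, every `U` meeting both sides belongs to `B`, and otherwise only
singletons remain and `W(U) = t ^ |U|`. Hence `W(U)` depends only on the numbers `k`, `l` of
vertices of `U` on the two sides. The recursion says that the exponential generating function `G`
of `W` agrees with `t * η(x + y) * G` in all terms that contain both `x` and `y`, and together with
the terms `W = tᵏ` for `l = 0` and `W = tˡ` for `k = 0` this determines `G`. The series built from
the asserted formula has both properties (`typeSeries_eq`, `egfCoeff_typeSeries_of_eq_zero`), by
`η(x + y) = η(x) + η(y) + α η(x) η(y)`. So it is `G` (`typeSum_bipartite`), and cancelling `t`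
gives the formula.
-/

open scoped Pointwise

namespace BipartiteNestohedra

/-! ### Faces of a nestohedron -/

section Faces

variable {V : Type*}

open scoped Classical in
/-- The elements of `S` at which `w` attains its maximum over `S`. -/
noncomputable def argmaxOn (w : V → ℝ) (S : Finset V) : Finset V :=
  S.filter fun i => ∀ j ∈ S, w j ≤ w i

theorem mem_argmaxOn {w : V → ℝ} {S : Finset V} {i : V} :
    i ∈ argmaxOn w S ↔ i ∈ S ∧ ∀ j ∈ S, w j ≤ w i := by
  simp [argmaxOn]

theorem argmaxOn_subset (w : V → ℝ) (S : Finset V) : argmaxOn w S ⊆ S :=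
  fun _ h => (mem_argmaxOn.1 h).1

theorem argmaxOn_nonempty (w : V → ℝ) {S : Finset V} (hS : S.Nonempty) :
    (argmaxOn w S).Nonempty := by
  obtain ⟨i, hi, h⟩ := S.exists_max_image w hS
  exact ⟨i, mem_argmaxOn.2 ⟨hi, h⟩⟩

/-- The maximum of `w` over `S` (for nonempty `S`), i.e. the support function of `Δ_S`. -/
noncomputable def maxOn (w : V → ℝ) (S : Finset V) : ℝ := ⨆ i : S, w i

theorem le_maxOn (w : V → ℝ) {S : Finset V} {i : V} (hi : i ∈ S) : w i ≤ maxOn w S :=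
  le_ciSup (f := fun i : S => w i) (Set.finite_range _).bddAbove ⟨i, hi⟩

theorem mem_argmaxOn_iff {w : V → ℝ} {S : Finset V} {i : V} :
    i ∈ argmaxOn w S ↔ i ∈ S ∧ w i = maxOn w S := by
  rw [mem_argmaxOn]
  refine and_congr_right fun hi => ⟨fun h => ?_, fun h j hj => h ▸ le_maxOn w hj⟩
  have : Nonempty S := ⟨⟨i, hi⟩⟩
  exact le_antisymm (le_maxOn w hi) (ciSup_le fun j => h j j.2)

variable [DecidableEq V]

theorem single_mem_simplexOn {S : Finset V} {i : V} (hi : i ∈ S) :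
    (Pi.single i 1 : V → ℝ) ∈ simplexOn S :=
  subset_convexHull ℝ _ ⟨i, hi, rfl⟩

theorem simplexOn_nonempty {S : Finset V} (hS : S.Nonempty) : (simplexOn S).Nonempty :=
  hS.elim fun _ hi => ⟨_, single_mem_simplexOn hi⟩

/-- The Minkowski sum of the simplices `Δ_{m S}`, `S ∈ B`. It is the nestohedron of `B` for
`m = id`, and its face on which `w` is maximal for `m = argmaxOn w`. -/
noncomputable def simplexSum (B : BuildingSet V) (m : Finset V → Finset V) : Set (V → ℝ) :=
  ∑ S ∈ B.sets, simplexOn (m S)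

theorem mem_simplexSum {B : BuildingSet V} {m : Finset V → Finset V} {x : V → ℝ} :
    x ∈ simplexSum B m ↔
      ∃ g : Finset V → V → ℝ, (∀ S ∈ B.sets, g S ∈ simplexOn (m S)) ∧ ∑ S ∈ B.sets, g S = x := by
  rw [simplexSum, Set.mem_finsetSum]
  constructor
  · rintro ⟨g, hg, h⟩
    exact ⟨g, fun S hS => hg hS, h⟩
  · rintro ⟨g, hg, h⟩
    exact ⟨g, fun {S} hS => hg S hS, h⟩

theorem simplexSum_nonempty {B : BuildingSet V} {m : Finset V → Finset V}
    (hm : ∀ S ∈ B.sets, (m S).Nonempty) : (simplexSum B m).Nonempty := by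
  choose! g hg using fun S hS => simplexOn_nonempty (hm S hS)
  exact ⟨_, mem_simplexSum.2 ⟨g, hg, rfl⟩⟩

theorem simplexSum_argmaxOn_nonempty (B : BuildingSet V) (w : V → ℝ) :
    (simplexSum B (argmaxOn w)).Nonempty :=
  simplexSum_nonempty fun S hS => argmaxOn_nonempty w (B.nonempty_of_mem S hS)

theorem simplexSum_congr {B : BuildingSet V} {m m' : Finset V → Finset V}
    (h : ∀ S ∈ B.sets, m S = m' S) : simplexSum B m = simplexSum B m' :=
  Finset.sum_congr rfl fun S hS => by rw [h S hS]

theorem vectorSpan_simplexOn (S : Finset V) :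
    vectorSpan ℝ (simplexOn S) =
      vectorSpan ℝ ((fun i : V => (Pi.single i 1 : V → ℝ)) '' (S : Set V)) := by
  rw [simplexOn, ← direction_affineSpan, affineSpan_convexHull, direction_affineSpan]

theorem vectorSpan_add {E : Type*} [AddCommGroup E] [Module ℝ E] {s t : Set E}
    (hs : s.Nonempty) (ht : t.Nonempty) :
    vectorSpan ℝ (s + t) = vectorSpan ℝ s ⊔ vectorSpan ℝ t := by
  obtain ⟨a, ha⟩ := hs
  obtain ⟨b, hb⟩ := ht
  apply le_antisymm
  · rw [vectorSpan_def, Submodule.span_le]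
    rintro _ ⟨_, ⟨x, hx, y, hy, rfl⟩, _, ⟨x', hx', y', hy', rfl⟩, rfl⟩
    simp only [vsub_eq_sub, add_sub_add_comm]
    exact Submodule.add_mem_sup (vsub_mem_vectorSpan ℝ hx hx') (vsub_mem_vectorSpan ℝ hy hy')
  · refine sup_le ?_ ?_ <;> rw [vectorSpan_def, Submodule.span_le]
    · rintro _ ⟨x, hx, x', hx', rfl⟩
      simpa using vsub_mem_vectorSpan ℝ (Set.add_mem_add hx hb) (Set.add_mem_add hx' hb)
    · rintro _ ⟨x, hx, x', hx', rfl⟩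
      simpa using vsub_mem_vectorSpan ℝ (Set.add_mem_add ha hx) (Set.add_mem_add ha hx')

theorem vectorSpan_sum {ι E : Type*} [AddCommGroup E] [Module ℝ E] (s : Finset ι)
    {f : ι → Set E} (hf : ∀ i ∈ s, (f i).Nonempty) :
    (∑ i ∈ s, f i).Nonempty ∧ vectorSpan ℝ (∑ i ∈ s, f i) = ⨆ i ∈ s, vectorSpan ℝ (f i) := by
  classical
  induction s using Finset.induction_on with
  | empty => simp [← Set.singleton_zero]
  | insert a s ha ih =>
    obtain ⟨h1, h2⟩ := ih fun i hi => hf i (Finset.mem_insert_of_mem hi)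
    have h3 := hf a (Finset.mem_insert_self a s)
    rw [Finset.sum_insert ha, vectorSpan_add h3 h1, h2, Finset.iSup_insert]
    exact ⟨h3.add h1, rfl⟩

variable [Fintype V]

theorem mem_simplexOn {S : Finset V} {x : V → ℝ} :
    x ∈ simplexOn S ↔ (∀ i, 0 ≤ x i) ∧ ∑ i, x i = 1 ∧ ∀ i ∉ S, x i = 0 := by
  constructor
  · intro hx
    have hsub : simplexOn S ⊆ stdSimplex ℝ V ∩ {x | ∀ i ∉ S, x i = 0} := by
      refine convexHull_min ?_ ((convex_stdSimplex ℝ V).inter ?_)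
      · rintro _ ⟨i, hi, rfl⟩
        refine ⟨single_mem_stdSimplex ℝ i, fun j hj => ?_⟩
        exact Pi.single_eq_of_ne (fun h => hj (by rwa [h])) _
      · intro x hx y hy a b _ _ _ i hi
        simp [hx i hi, hy i hi]
    obtain ⟨⟨h0, h1⟩, h2⟩ := hsub hx
    exact ⟨h0, h1, h2⟩
  · rintro ⟨h0, h1, h2⟩
    have hS : ∑ i ∈ S, x i = 1 := by
      rw [← h1]
      exact Finset.sum_subset (Finset.subset_univ S) fun i _ hi => h2 i hi
    have hx : x = ∑ i ∈ S, x i • (Pi.single i 1 : V → ℝ) := by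
      ext j
      by_cases hj : j ∈ S <;> simp [Finset.sum_apply, Pi.single_apply, hj, h2]
    rw [hx]
    exact (convex_convexHull ℝ _).sum_mem (fun i _ => h0 i) hS
      fun i hi => subset_convexHull ℝ _ ⟨i, hi, rfl⟩

theorem maxOn_sub_dotProduct {S : Finset V} (w : V → ℝ) {x : V → ℝ} (hx : x ∈ simplexOn S) :
    maxOn w S - x ⬝ᵥ w = ∑ i, x i * (maxOn w S - w i) := by
  simp only [mul_sub, Finset.sum_sub_distrib, ← Finset.sum_mul, (mem_simplexOn.1 hx).2.1, one_mul,
    dotProduct]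

theorem mul_maxOn_sub_nonneg {S : Finset V} (w : V → ℝ) {x : V → ℝ} (hx : x ∈ simplexOn S)
    (i : V) : 0 ≤ x i * (maxOn w S - w i) := by
  by_cases hi : i ∈ S
  · exact mul_nonneg ((mem_simplexOn.1 hx).1 i) (sub_nonneg.2 (le_maxOn w hi))
  · simp [(mem_simplexOn.1 hx).2.2 i hi]

theorem dotProduct_le_maxOn {S : Finset V} (w : V → ℝ) {x : V → ℝ} (hx : x ∈ simplexOn S) :
    x ⬝ᵥ w ≤ maxOn w S := by
  rw [← sub_nonneg, maxOn_sub_dotProduct w hx]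
  exact Finset.sum_nonneg fun i _ => mul_maxOn_sub_nonneg w hx i

theorem mem_simplexOn_argmaxOn {S : Finset V} {w x : V → ℝ} :
    x ∈ simplexOn (argmaxOn w S) ↔ x ∈ simplexOn S ∧ x ⬝ᵥ w = maxOn w S := by
  constructor
  · intro h
    have hx : x ∈ simplexOn S :=
      convexHull_mono (Set.image_mono (Finset.coe_subset.2 (argmaxOn_subset w S))) h
    refine ⟨hx, (sub_eq_zero.1 ?_).symm⟩
    rw [maxOn_sub_dotProduct w hx]
    refine Finset.sum_eq_zero fun i _ => ?_
    by_cases hi : i ∈ argmaxOn w S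
    · rw [(mem_argmaxOn_iff.1 hi).2, sub_self, mul_zero]
    · rw [(mem_simplexOn.1 h).2.2 i hi, zero_mul]
  · rintro ⟨hx, h⟩
    have h0 := maxOn_sub_dotProduct w hx
    rw [h, sub_self, eq_comm, Finset.sum_eq_zero_iff_of_nonneg
      fun i _ => mul_maxOn_sub_nonneg w hx i] at h0
    obtain ⟨hx0, hx1, hxS⟩ := mem_simplexOn.1 hx
    refine mem_simplexOn.2 ⟨hx0, hx1, fun i hi => ?_⟩
    by_cases hiS : i ∈ S
    · refine (mul_eq_zero.1 (h0 i (Finset.mem_univ i))).resolve_right fun h' => hi ?_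
      exact mem_argmaxOn_iff.2 ⟨hiS, (sub_eq_zero.1 h').symm⟩
    · exact hxS i hiS

/-- The support function of a Minkowski sum is the sum of the support functions. -/
theorem dotProduct_le_sum_maxOn {B : BuildingSet V} (w : V → ℝ) {x : V → ℝ}
    (hx : x ∈ nestohedron B) : x ⬝ᵥ w ≤ ∑ S ∈ B.sets, maxOn w S := by
  obtain ⟨g, hg, rfl⟩ := (mem_simplexSum (m := id)).1 hx
  rw [sum_dotProduct]
  exact Finset.sum_le_sum fun S hS => dotProduct_le_maxOn w (hg S hS)

theorem mem_simplexSum_argmaxOn {B : BuildingSet V} {w x : V → ℝ} :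
    x ∈ simplexSum B (argmaxOn w) ↔
      x ∈ nestohedron B ∧ x ⬝ᵥ w = ∑ S ∈ B.sets, maxOn w S := by
  constructor
  · intro h
    obtain ⟨g, hg, rfl⟩ := mem_simplexSum.1 h
    refine ⟨(mem_simplexSum (m := id)).2
      ⟨g, fun S hS => (mem_simplexOn_argmaxOn.1 (hg S hS)).1, rfl⟩, ?_⟩
    rw [sum_dotProduct]
    exact Finset.sum_congr rfl fun S hS => (mem_simplexOn_argmaxOn.1 (hg S hS)).2
  · rintro ⟨h, hw⟩
    obtain ⟨g, hg, rfl⟩ := (mem_simplexSum (m := id)).1 h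
    rw [sum_dotProduct] at hw
    replace hw := (Finset.sum_eq_sum_iff_of_le
      fun S hS => dotProduct_le_maxOn w (hg S hS)).1 hw
    exact mem_simplexSum.2
      ⟨g, fun S hS => mem_simplexOn_argmaxOn.2 ⟨hg S hS, hw S hS⟩, rfl⟩

theorem setOf_maximal_eq_simplexSum (B : BuildingSet V) (w : V → ℝ) :
    {x ∈ nestohedron B | ∀ y ∈ nestohedron B, y ⬝ᵥ w ≤ x ⬝ᵥ w} = simplexSum B (argmaxOn w) := by
  ext x
  rw [mem_simplexSum_argmaxOn]
  refine and_congr_right fun hx => ⟨fun h => ?_, fun h y hy => h ▸ dotProduct_le_sum_maxOn w hy⟩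
  obtain ⟨y, hy⟩ := simplexSum_argmaxOn_nonempty B w
  rw [mem_simplexSum_argmaxOn] at hy
  exact le_antisymm (dotProduct_le_sum_maxOn w hx) (hy.2 ▸ h y hy.1)

/-- The faces of a nestohedron are the Minkowski sums of the corresponding faces of its
summands. -/
theorem isFace_nestohedron_iff {B : BuildingSet V} {F : Set (V → ℝ)} :
    IsFace (nestohedron B) F ↔ ∃ w, simplexSum B (argmaxOn w) = F := by
  constructor
  · rintro ⟨hne, hF⟩
    obtain ⟨l, rfl⟩ := hF hne
    have hl : ∀ x, l x = x ⬝ᵥ fun i => l (Pi.single i 1) := fun x => by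
      refine (LinearMap.pi_apply_eq_sum_univ l.toLinearMap x).trans ?_
      refine Finset.sum_congr rfl fun i _ => ?_
      change x i * l _ = x i * l _
      congr 2
      ext j
      simp [Pi.single_apply, eq_comm]
    refine ⟨fun i => l (Pi.single i 1), ?_⟩
    rw [← setOf_maximal_eq_simplexSum]
    simp only [← hl]
  · rintro ⟨w, rfl⟩
    refine ⟨simplexSum_argmaxOn_nonempty B w, fun _ => ?_⟩
    refine ⟨∑ i, w i • ContinuousLinearMap.proj i, ?_⟩
    rw [← setOf_maximal_eq_simplexSum]
    simp [dotProduct, mul_comm]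

/-- If one face of a nestohedron lies in another, so do its summands: a sum of vertices of the
summands maximizes a functional only if every one of these vertices does. -/
theorem argmaxOn_subset_of_simplexSum_subset {B : BuildingSet V} {w w' : V → ℝ}
    (h : simplexSum B (argmaxOn w) ⊆ simplexSum B (argmaxOn w')) {S : Finset V}
    (hS : S ∈ B.sets) : argmaxOn w S ⊆ argmaxOn w' S := by
  intro i hi
  have : Nonempty V := ⟨i⟩
  have hne : ∀ T ∈ B.sets, ∃ v, v ∈ argmaxOn w T ∧ (T = S → v = i) := by
    intro T hT
    by_cases hTS : T = S
    · exact ⟨i, hTS ▸ hi, fun _ => rfl⟩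
    · obtain ⟨v, hv⟩ := argmaxOn_nonempty w (B.nonempty_of_mem T hT)
      exact ⟨v, hv, fun h => absurd h hTS⟩
  choose! v hv hvS using hne
  have hmem : ∑ T ∈ B.sets, (Pi.single (v T) 1 : V → ℝ) ∈ simplexSum B (argmaxOn w) :=
    mem_simplexSum.2 ⟨fun T => Pi.single (v T) 1, fun T hT => single_mem_simplexOn (hv T hT), rfl⟩
  have hmax := (mem_simplexSum_argmaxOn.1 (h hmem)).2
  simp only [sum_dotProduct, single_dotProduct, one_mul] at hmax
  rw [Finset.sum_eq_sum_iff_of_le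
    fun T hT => le_maxOn w' (argmaxOn_subset w T (hv T hT))] at hmax
  have := hmax S hS
  rw [hvS S hS rfl] at this
  exact mem_argmaxOn_iff.2 ⟨argmaxOn_subset w S hi, this⟩

theorem argmaxOn_eq_of_simplexSum_eq {B : BuildingSet V} {w w' : V → ℝ}
    (h : simplexSum B (argmaxOn w) = simplexSum B (argmaxOn w')) {S : Finset V}
    (hS : S ∈ B.sets) : argmaxOn w S = argmaxOn w' S :=
  (argmaxOn_subset_of_simplexSum_subset h.le hS).antisymm
    (argmaxOn_subset_of_simplexSum_subset h.ge hS)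

theorem finrank_vectorSpan_simplexOn {S : Finset V} (hS : S.Nonempty) :
    Module.finrank ℝ (vectorSpan ℝ (simplexOn S)) = S.card - 1 := by
  have hli : AffineIndependent ℝ fun i : V => (Pi.single i 1 : V → ℝ) := by
    have := (Pi.basisFun ℝ V).linearIndependent.affineIndependent
    rwa [show ⇑(Pi.basisFun ℝ V) = fun i : V => (Pi.single i 1 : V → ℝ) from
      funext fun i => Pi.basisFun_apply ℝ V i] at this
  have hS' : AffineIndependent ℝ fun i : S => (Pi.single (i : V) 1 : V → ℝ) :=
    hli.comp_embedding (Function.Embedding.subtype _)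
  have hc : Fintype.card S = (S.card - 1) + 1 := by
    rw [Fintype.card_coe, Nat.sub_add_cancel hS.card_pos]
  rw [vectorSpan_simplexOn, ← hS'.finrank_vectorSpan hc]
  rw [Set.image_eq_range]
  rfl

theorem eq_zero_of_mem_vectorSpan_simplexOn {S : Finset V} {x : V → ℝ}
    (hx : x ∈ vectorSpan ℝ (simplexOn S)) {i : V} (hi : i ∉ S) : x i = 0 := by
  have hle : vectorSpan ℝ (simplexOn S) ≤ LinearMap.ker (LinearMap.proj i : (V → ℝ) →ₗ[ℝ] ℝ) := by
    rw [vectorSpan_def, Submodule.span_le]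
    rintro _ ⟨x, hx, y, hy, rfl⟩
    simp [(mem_simplexOn.1 hx).2.2 i hi, (mem_simplexOn.1 hy).2.2 i hi]
  exact hle hx

end Faces

/-! ### Combinatorial types of faces -/

section Types

variable {V : Type*}

theorem argmaxOn_congr {w w' : V → ℝ} {S : Finset V} (h : ∀ i ∈ S, w i = w' i) :
    argmaxOn w S = argmaxOn w' S := by
  ext i
  rw [mem_argmaxOn, mem_argmaxOn]
  refine and_congr_right fun hi => forall₂_congr fun j hj => ?_
  rw [h i hi, h j hj]

theorem argmaxOn_of_card_eq_one (w : V → ℝ) {S : Finset V} (hS : S.card = 1) :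
    argmaxOn w S = S := by
  obtain ⟨i, rfl⟩ := Finset.card_eq_one.1 hS
  exact (Finset.Nonempty.subset_singleton_iff (argmaxOn_nonempty w ⟨i, by simp⟩)).1
    (argmaxOn_subset w _)

variable [DecidableEq V]

theorem argmaxOn_eq_inter {w : V → ℝ} {S A : Finset V} (hSA : (S ∩ A).Nonempty) {c : ℝ}
    (hA : ∀ i ∈ A, w i = c) (hS : ∀ i ∈ S, i ∉ A → w i < c) : argmaxOn w S = S ∩ A := by
  ext i
  rw [mem_argmaxOn, Finset.mem_inter]
  refine and_congr_right fun hi => ⟨fun h => ?_, fun hiA j hj => ?_⟩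
  · by_contra hiA
    obtain ⟨j, hj⟩ := hSA
    rw [Finset.mem_inter] at hj
    exact (hS i hi hiA).not_ge (hA j hj.2 ▸ h j hj.1)
  · rw [hA i hiA]
    by_cases hjA : j ∈ A
    · exact (hA j hjA).le
    · exact (hS j hj hjA).le

/-- The combinatorial type of the face of the nestohedron of `B|_U` on which `w` is maximal: it
sends each `S ∈ B` contained in `U` to the subset of `S` on which `w` is maximal, and all other
sets to `∅`. -/
noncomputable def argmaxType (B : BuildingSet V) (U : Finset V) (w : V → ℝ) :
    Finset V → Finset V :=
  fun S => if S ∈ B.sets ∧ S ⊆ U then argmaxOn w S else ∅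

theorem argmaxType_of_mem {B : BuildingSet V} {U S : Finset V} (w : V → ℝ) (hS : S ∈ B.sets)
    (hSU : S ⊆ U) : argmaxType B U w S = argmaxOn w S :=
  if_pos ⟨hS, hSU⟩

theorem argmaxType_subset (B : BuildingSet V) (U : Finset V) (w : V → ℝ) (S : Finset V) :
    argmaxType B U w S ⊆ U := by
  rw [argmaxType]
  split_ifs with h
  · exact (argmaxOn_subset w S).trans h.2
  · exact Finset.empty_subset U

/-- The type of a face of the nestohedron of `B|_U` whose functional is maximal on `A ⊆ U`, when
the restriction of the functional to `U \ A` has type `m`. -/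
def consType (B : BuildingSet V) (U A : Finset V) (m : Finset V → Finset V) :
    Finset V → Finset V :=
  fun S => if S ∈ B.sets ∧ S ⊆ U then (if (S ∩ A).Nonempty then S ∩ A else m S) else ∅

/-- If `w` takes its maximum over `U` exactly on `A`, a set `S ⊆ U` meeting `A` has its maximum
locus `S ∩ A`, and any other one lies in `U \ A`. -/
theorem argmaxType_eq_consType (B : BuildingSet V) {U A : Finset V} {w w' : V → ℝ} {c : ℝ}
    (hA : ∀ i ∈ A, w i = c) (hU : ∀ i ∈ U, i ∉ A → w i < c)
    (hw : ∀ i, i ∉ A → w i = w' i) :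
    argmaxType B U w = consType B U A (argmaxType B (U \ A) w') := by
  funext S
  rw [argmaxType, consType]
  split_ifs with h hSA
  · exact argmaxOn_eq_inter hSA hA fun i hi => hU i (h.2 hi)
  · have hdisj : ∀ i ∈ S, i ∉ A := fun i hi hiA => hSA ⟨i, Finset.mem_inter.2 ⟨hi, hiA⟩⟩
    rw [argmaxType_of_mem w' h.1 fun i hi => Finset.mem_sdiff.2 ⟨h.2 hi, hdisj i hi⟩]
    exact argmaxOn_congr fun i hi => hw i (hdisj i hi)
  · rfl

theorem argmaxType_eq_consType_argmaxOn (B : BuildingSet V) (U : Finset V) (w : V → ℝ) :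
    argmaxType B U w =
      consType B U (argmaxOn w U) (argmaxType B (U \ argmaxOn w U) w) := by
  refine argmaxType_eq_consType B (c := maxOn w U) (fun i hi => (mem_argmaxOn_iff.1 hi).2)
    (fun i hi hiA => ?_) fun _ _ => rfl
  exact (le_maxOn w hi).lt_of_ne fun h => hiA (mem_argmaxOn_iff.2 ⟨hi, h⟩)

/-- The linear space parallel to a face of type `m`. -/
noncomputable def directionSpace (m : Finset V → Finset V) : Submodule ℝ (V → ℝ) :=
  ⨆ S, vectorSpan ℝ (simplexOn (m S))

/-- The dimension of a face of type `m`. -/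
noncomputable def typeDim (m : Finset V → Finset V) : ℕ :=
  Module.finrank ℝ (directionSpace m)

theorem simplexOn_empty : simplexOn (∅ : Finset V) = ∅ := by
  simp [simplexOn]

variable [Fintype V]

theorem eq_zero_of_mem_directionSpace {m : Finset V → Finset V} {x : V → ℝ} {i : V}
    (hm : ∀ S, i ∉ m S) (hx : x ∈ directionSpace m) : x i = 0 := by
  have hle : directionSpace m ≤ LinearMap.ker (LinearMap.proj i : (V → ℝ) →ₗ[ℝ] ℝ) :=
    iSup_le fun S y hy => eq_zero_of_mem_vectorSpan_simplexOn hy (hm S)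
  exact hle hx

theorem typeDim_le_card {U : Finset V} {m : Finset V → Finset V} (hm : ∀ S, m S ⊆ U) :
    typeDim m ≤ U.card := by
  let E : Finset (V → ℝ) := U.image fun i => Pi.single i 1
  have hle : directionSpace m ≤ Submodule.span ℝ (E : Set (V → ℝ)) := by
    refine iSup_le fun S => ?_
    rw [vectorSpan_simplexOn, vectorSpan_def, Submodule.span_le]
    rintro _ ⟨_, ⟨i, hi, rfl⟩, _, ⟨j, hj, rfl⟩, rfl⟩
    exact Submodule.sub_mem _
      (Submodule.subset_span (Finset.mem_image_of_mem _ (hm S hi)))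
      (Submodule.subset_span (Finset.mem_image_of_mem _ (hm S hj)))
  exact (Submodule.finrank_mono hle).trans ((finrank_span_finset_le_card E).trans
    Finset.card_image_le)

theorem typeDim_consType {B : BuildingSet V} {U A : Finset V} (hU : U ∈ B.sets) (hAU : A ⊆ U)
    (hA : A.Nonempty) {w : V → ℝ} :
    typeDim (consType B U A (argmaxType B (U \ A) w)) =
      A.card - 1 + typeDim (argmaxType B (U \ A) w) := by
  set m := argmaxType B (U \ A) w with hm
  have hsup : directionSpace (consType B U A m) =
      vectorSpan ℝ (simplexOn A) ⊔ directionSpace m := by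
    apply le_antisymm
    · refine iSup_le fun S => ?_
      rw [consType]
      split_ifs with h hSA
      · exact le_sup_of_le_left (vectorSpan_mono ℝ (convexHull_mono (Set.image_mono
          (Finset.coe_subset.2 Finset.inter_subset_right))))
      · exact le_sup_of_le_right (le_iSup (fun S => vectorSpan ℝ (simplexOn (m S))) S)
      · simp [simplexOn_empty]
    · refine sup_le ?_ (iSup_le fun S => ?_)
      · have hUA : consType B U A m U = A := by
          rw [consType, if_pos ⟨hU, subset_rfl⟩, Finset.inter_eq_right.2 hAU, if_pos hA]
        conv_lhs => rw [← hUA]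
        exact le_iSup (fun S => vectorSpan ℝ (simplexOn (consType B U A m S))) U
      · by_cases h : S ∈ B.sets ∧ S ⊆ U \ A
        · have hSm : consType B U A m S = m S := by
            rw [consType, if_pos ⟨h.1, h.2.trans Finset.sdiff_subset⟩, if_neg]
            rintro ⟨i, hi⟩
            rw [Finset.mem_inter] at hi
            exact (Finset.mem_sdiff.1 (h.2 hi.1)).2 hi.2
          rw [← hSm]
          exact le_iSup (fun S => vectorSpan ℝ (simplexOn (consType B U A m S))) S
        · rw [hm, argmaxType, if_neg h]
          simp [simplexOn_empty]
  have hinf : vectorSpan ℝ (simplexOn A) ⊓ directionSpace m = ⊥ := by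
    refine (Submodule.eq_bot_iff _).2 fun x hx => funext fun i => ?_
    by_cases hi : i ∈ A
    · exact eq_zero_of_mem_directionSpace (fun S hiS =>
        (Finset.mem_sdiff.1 (argmaxType_subset B _ w S hiS)).2 hi) hx.2
    · exact eq_zero_of_mem_vectorSpan_simplexOn hx.1 hi
  have h := Submodule.finrank_sup_add_finrank_inf_eq (vectorSpan ℝ (simplexOn A))
    (directionSpace m)
  rw [hinf, finrank_bot, add_zero, finrank_vectorSpan_simplexOn hA] at h
  rw [typeDim, hsup, h, typeDim]

/-- The types of all the faces of the nestohedron of `B|_U`. -/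
noncomputable def argmaxTypes (B : BuildingSet V) (U : Finset V) :
    Finset (Finset V → Finset V) :=
  (Set.toFinite (Set.range (argmaxType B U))).toFinset

theorem mem_argmaxTypes {B : BuildingSet V} {U : Finset V} {m : Finset V → Finset V} :
    m ∈ argmaxTypes B U ↔ ∃ w, argmaxType B U w = m := by
  simp [argmaxTypes]

/-- The sum of `α ^ dim * t ^ (|U| - dim)` over the face types for `U`. If `U ∈ B`, it is `t`
times the f-polynomial of the nestohedron of `B|_U`, as that one has dimension `|U| - 1`. -/
noncomputable def typeSum (B : BuildingSet V) (U : Finset V) : Coeff :=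
  ∑ m ∈ argmaxTypes B U, varα ^ typeDim m * varT ^ (U.card - typeDim m)

/-- The number `n!` times the coefficient of `zⁿ` in `η(z)`. -/
noncomputable def etaCoeff (n : ℕ) : Coeff := if n = 0 then 0 else varα ^ (n - 1)

/-- A face type for `U ∈ B` amounts to a nonempty set `A ⊆ U` (the maximum locus on `U`) and a
face type for `U \ A`. -/
theorem typeSum_eq_sum_powerset {B : BuildingSet V} {U : Finset V} (hU : U ∈ B.sets) :
    typeSum B U =
      ∑ A ∈ U.powerset, etaCoeff A.card * (varT * typeSum B (U \ A)) := by
  have hfilter : ∑ A ∈ U.powerset, etaCoeff A.card * (varT * typeSum B (U \ A)) =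
      ∑ A ∈ U.powerset with A.Nonempty, etaCoeff A.card * (varT * typeSum B (U \ A)) := by
    refine (Finset.sum_filter_of_ne fun A _ hA => ?_).symm
    by_contra h
    rw [Finset.not_nonempty_iff_eq_empty] at h
    simp [h, etaCoeff] at hA
  rw [hfilter]
  simp only [typeSum, Finset.mul_sum]
  rw [Finset.sum_sigma']
  symm
  refine Finset.sum_bij (fun p _ => consType B U p.1 p.2) ?_ ?_ ?_ ?_
  · rintro ⟨A, m⟩ hp
    simp only [Finset.mem_sigma, Finset.mem_filter, Finset.mem_powerset, mem_argmaxTypes] at hp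
    obtain ⟨-, w, rfl⟩ := hp
    -- Raise `w` on `A` above all its values elsewhere.
    refine mem_argmaxTypes.2 ⟨fun i => if i ∈ A then 1 + ∑ j, |w j| else w i, ?_⟩
    refine argmaxType_eq_consType B (c := 1 + ∑ j, |w j|) (fun i hi => if_pos hi)
      (fun i _ hi => ?_) fun i hi => if_neg hi
    rw [if_neg hi]
    have h1 := Finset.single_le_sum (fun j _ => abs_nonneg (w j)) (Finset.mem_univ i)
    have h2 := le_abs_self (w i)
    linarith
  · rintro ⟨A₁, m₁⟩ h₁ ⟨A₂, m₂⟩ h₂ h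
    simp only [Finset.mem_sigma, Finset.mem_filter, Finset.mem_powerset, mem_argmaxTypes] at h₁ h₂
    obtain ⟨⟨hA₁, hne₁⟩, w₁, rfl⟩ := h₁
    obtain ⟨⟨hA₂, hne₂⟩, w₂, rfl⟩ := h₂
    have hA : A₁ = A₂ := by
      have hUU := congrFun h U
      simpa [consType, hU, Finset.inter_eq_right.2 hA₁, Finset.inter_eq_right.2 hA₂, hne₁, hne₂]
        using hUU
    subst hA
    refine Sigma.ext rfl (heq_of_eq ?_)
    dsimp only at h ⊢
    funext S
    by_cases hS : S ∈ B.sets ∧ S ⊆ U \ A₁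
    · have hSS := congrFun h S
      have hSA : ¬ (S ∩ A₁).Nonempty := by
        rintro ⟨i, hi⟩
        rw [Finset.mem_inter] at hi
        exact (Finset.mem_sdiff.1 (hS.2 hi.1)).2 hi.2
      simpa only [consType, if_pos (And.intro hS.1 (hS.2.trans Finset.sdiff_subset)),
        if_neg hSA] using hSS
    · rw [argmaxType, argmaxType, if_neg hS, if_neg hS]
  · intro m hm
    obtain ⟨w, rfl⟩ := mem_argmaxTypes.1 hm
    refine ⟨⟨argmaxOn w U, argmaxType B (U \ argmaxOn w U) w⟩, ?_,
      (argmaxType_eq_consType_argmaxOn B U w).symm⟩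
    simp only [Finset.mem_sigma, Finset.mem_filter, Finset.mem_powerset, mem_argmaxTypes]
    exact ⟨⟨argmaxOn_subset w U, argmaxOn_nonempty w (B.nonempty_of_mem U hU)⟩, w, rfl⟩
  · rintro ⟨A, m⟩ hp
    simp only [Finset.mem_sigma, Finset.mem_filter, Finset.mem_powerset, mem_argmaxTypes] at hp
    obtain ⟨⟨hA, hne⟩, w, rfl⟩ := hp
    have hd := typeDim_le_card (argmaxType_subset B (U \ A) w)
    have hcard := Finset.card_sdiff_add_card_eq_card hA
    have hpos := hne.card_pos
    rw [typeDim_consType hU hA hne, etaCoeff, if_neg hpos.ne',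
      show U.card - (A.card - 1 + typeDim (argmaxType B (U \ A) w)) =
        (U \ A).card - typeDim (argmaxType B (U \ A) w) + 1 by omega]
    ring

/-- If all elements of `B|_U` are singletons, its nestohedron is a point, and there is a single
face type. -/
theorem typeSum_of_card_eq_one {B : BuildingSet V} {U : Finset V}
    (hU : ∀ S ∈ B.sets, S ⊆ U → S.card = 1) : typeSum B U = varT ^ U.card := by
  have hw : ∀ w, argmaxType B U w = argmaxType B U 0 := by
    intro w
    funext S
    rw [argmaxType, argmaxType]
    split_ifs with h
    · rw [argmaxOn_of_card_eq_one w (hU S h.1 h.2), argmaxOn_of_card_eq_one 0 (hU S h.1 h.2)]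
    · rfl
  have hsingle : argmaxTypes B U = {argmaxType B U 0} := by
    ext m
    simp [mem_argmaxTypes, hw, eq_comm]
  have hdim : typeDim (argmaxType B U 0) = 0 := by
    rw [typeDim, Submodule.finrank_eq_zero, directionSpace, iSup_eq_bot]
    intro S
    rw [argmaxType]
    split_ifs with h
    · rw [argmaxOn_of_card_eq_one 0 (hU S h.1 h.2), ← Submodule.finrank_eq_zero (R := ℝ),
        finrank_vectorSpan_simplexOn (B.nonempty_of_mem S h.1), hU S h.1 h.2]
    · simp [simplexOn_empty]
  rw [typeSum, hsingle, Finset.sum_singleton, hdim, pow_zero, one_mul, Nat.sub_zero]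

theorem simplexSum_argmaxType (B : BuildingSet V) (w : V → ℝ) :
    simplexSum B (argmaxType B Finset.univ w) = simplexSum B (argmaxOn w) :=
  simplexSum_congr fun S hS => argmaxType_of_mem w hS (Finset.subset_univ S)

theorem setDim_simplexSum_argmaxOn (B : BuildingSet V) (w : V → ℝ) :
    setDim (simplexSum B (argmaxOn w)) = typeDim (argmaxType B Finset.univ w) := by
  rw [setDim, simplexSum, (vectorSpan_sum _ fun S hS =>
    simplexOn_nonempty (argmaxOn_nonempty w (B.nonempty_of_mem S hS))).2, typeDim, directionSpace]
  suffices h : ∀ S, ⨆ (_ : S ∈ B.sets), vectorSpan ℝ (simplexOn (argmaxOn w S)) =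
      vectorSpan ℝ (simplexOn (argmaxType B Finset.univ w S)) by
    exact congrArg (fun p : Submodule ℝ (V → ℝ) => Module.finrank ℝ p) (iSup_congr h)
  intro S
  by_cases hS : S ∈ B.sets
  · simp [hS, argmaxType_of_mem w hS (Finset.subset_univ S)]
  · simp [hS, argmaxType, simplexOn_empty]

theorem injOn_simplexSum (B : BuildingSet V) :
    Set.InjOn (simplexSum B) (argmaxTypes B Finset.univ) := by
  intro m hm m' hm' h
  obtain ⟨w, rfl⟩ := mem_argmaxTypes.1 hm
  obtain ⟨w', rfl⟩ := mem_argmaxTypes.1 hm'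
  rw [simplexSum_argmaxType, simplexSum_argmaxType] at h
  funext S
  rw [argmaxType, argmaxType]
  split_ifs with hS
  · exact argmaxOn_eq_of_simplexSum_eq h hS.1
  · rfl

theorem faceCount_nestohedron (B : BuildingSet V) (i : ℕ) :
    faceCount (nestohedron B) i =
      ((argmaxTypes B Finset.univ).filter fun m => typeDim m = i).card := by
  classical
  rw [← Finset.card_image_of_injOn ((injOn_simplexSum B).mono
    (Finset.coe_subset.2 (Finset.filter_subset _ _))), ← Set.ncard_coe_finset, faceCount]
  congr 1
  ext F
  simp only [Set.mem_ofPred_eq, isFace_nestohedron_iff, Finset.coe_image, Set.mem_image,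
    Finset.mem_coe, Finset.mem_filter, mem_argmaxTypes]
  constructor
  · rintro ⟨⟨w, rfl⟩, h⟩
    exact ⟨_, ⟨⟨w, rfl⟩, by rw [← setDim_simplexSum_argmaxOn, h]⟩, simplexSum_argmaxType B w⟩
  · rintro ⟨_, ⟨⟨w, rfl⟩, h⟩, rfl⟩
    rw [simplexSum_argmaxType, setDim_simplexSum_argmaxOn]
    exact ⟨⟨w, rfl⟩, h⟩

theorem typeDim_le_setDim (B : BuildingSet V) (w : V → ℝ) :
    typeDim (argmaxType B Finset.univ w) ≤ setDim (nestohedron B) := by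
  rw [← setDim_simplexSum_argmaxOn]
  exact Submodule.finrank_mono (vectorSpan_mono ℝ fun x hx => (mem_simplexSum_argmaxOn.1 hx).1)

theorem fPolynomial_nestohedron (B : BuildingSet V) :
    fPolynomial (nestohedron B) = ∑ m ∈ argmaxTypes B Finset.univ,
      varα ^ typeDim m * varT ^ (setDim (nestohedron B) - typeDim m) := by
  rw [fPolynomial, ← Finset.sum_fiberwise_of_maps_to
    (t := Finset.range (setDim (nestohedron B) + 1)) (g := typeDim)]
  · refine Finset.sum_congr rfl fun i _ => ?_
    rw [faceCount_nestohedron, mul_assoc, ← nsmul_eq_mul]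
    refine (Finset.sum_eq_card_nsmul fun m hm => ?_).symm
    rw [(Finset.mem_filter.1 hm).2]
  · intro m hm
    obtain ⟨w, rfl⟩ := mem_argmaxTypes.1 hm
    exact Finset.mem_range.2 (Nat.lt_succ_of_le (typeDim_le_setDim B w))

theorem setDim_nestohedron {B : BuildingSet V} (hB : Finset.univ ∈ B.sets) :
    setDim (nestohedron B) = Fintype.card V - 1 := by
  have hone : ∀ S : Finset V, argmaxOn (0 : V → ℝ) S = S := fun S => by simp [argmaxOn]
  have hP : nestohedron B = simplexSum B (argmaxOn 0) :=
    simplexSum_congr (m := id) fun S _ => (hone S).symm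
  have hd := typeDim_le_card (argmaxType_subset B (Finset.univ \ Finset.univ) (0 : V → ℝ))
  rw [Finset.sdiff_self, Finset.card_empty, Nat.le_zero] at hd
  rw [hP, setDim_simplexSum_argmaxOn, argmaxType_eq_consType_argmaxOn, hone,
    typeDim_consType hB subset_rfl (B.nonempty_of_mem _ hB), Finset.sdiff_self, hd, add_zero,
    Finset.card_univ]

theorem varT_mul_fPolynomial_nestohedron {B : BuildingSet V} (hB : Finset.univ ∈ B.sets) :
    varT * fPolynomial (nestohedron B) = typeSum B Finset.univ := by
  rw [fPolynomial_nestohedron, typeSum, Finset.mul_sum]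
  refine Finset.sum_congr rfl fun m hm => ?_
  obtain ⟨w, rfl⟩ := mem_argmaxTypes.1 hm
  have hd := typeDim_le_setDim B w
  have hpos := (B.nonempty_of_mem _ hB).card_pos
  rw [Finset.card_univ] at hpos
  rw [setDim_nestohedron hB] at hd ⊢
  rw [Finset.card_univ, show Fintype.card V - typeDim (argmaxType B Finset.univ w) =
    Fintype.card V - 1 - typeDim (argmaxType B Finset.univ w) + 1 by omega]
  ring

end Types

/-! ### Series in two variables -/

section Series

/-- The exponent of the monomial `xᵏ yˡ`. -/
noncomputable def monomialExp (k l : ℕ) : Fin 2 →₀ ℕ :=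
  Finsupp.single 0 k + Finsupp.single 1 l

@[simp] theorem monomialExp_zero (k l : ℕ) : monomialExp k l 0 = k := by simp [monomialExp]

@[simp] theorem monomialExp_one (k l : ℕ) : monomialExp k l 1 = l := by simp [monomialExp]

theorem monomialExp_eq (e : Fin 2 →₀ ℕ) : monomialExp (e 0) (e 1) = e := by
  ext i
  fin_cases i <;> simp

theorem monomialExp_eq_single_zero {k l n : ℕ} :
    monomialExp k l = Finsupp.single 0 n ↔ k = n ∧ l = 0 := by
  simp [Finsupp.ext_iff, Fin.forall_fin_two]

theorem monomialExp_eq_single_one {k l n : ℕ} :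
    monomialExp k l = Finsupp.single 1 n ↔ k = 0 ∧ l = n := by
  simp [Finsupp.ext_iff, Fin.forall_fin_two]

theorem coeff_mul_monomialExp (F G : Series) (k l : ℕ) :
    MvPowerSeries.coeff (monomialExp k l) (F * G) =
      ∑ i ∈ Finset.range (k + 1), ∑ j ∈ Finset.range (l + 1),
        MvPowerSeries.coeff (monomialExp i j) F *
          MvPowerSeries.coeff (monomialExp (k - i) (l - j)) G := by
  rw [MvPowerSeries.coeff_mul, ← Finset.sum_product']
  refine Finset.sum_bij' (fun p _ => (p.1 0, p.1 1))
    (fun q _ => (monomialExp q.1 q.2, monomialExp (k - q.1) (l - q.2))) ?_ ?_ ?_ ?_ ?_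
  · intro p hp
    rw [Finset.HasAntidiagonal.mem_antidiagonal] at hp
    have h0 := DFunLike.congr_fun hp 0
    have h1 := DFunLike.congr_fun hp 1
    simp only [Finsupp.add_apply, monomialExp_zero, monomialExp_one] at h0 h1
    simp only [Finset.mem_product, Finset.mem_range]
    omega
  · rintro ⟨i, j⟩ hq
    simp only [Finset.mem_product, Finset.mem_range] at hq
    rw [Finset.HasAntidiagonal.mem_antidiagonal, Finsupp.ext_iff, Fin.forall_fin_two]
    simp only [Finsupp.add_apply, monomialExp_zero, monomialExp_one]
    omega
  · intro p hp
    rw [Finset.HasAntidiagonal.mem_antidiagonal] at hp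
    have h0 := DFunLike.congr_fun hp 0
    have h1 := DFunLike.congr_fun hp 1
    simp only [Finsupp.add_apply, monomialExp_zero, monomialExp_one] at h0 h1
    refine Prod.ext (monomialExp_eq _) ?_
    simp only [← h0, ← h1, Nat.add_sub_cancel_left, monomialExp_eq]
  · rintro ⟨i, j⟩ _
    simp
  · intro p hp
    rw [Finset.HasAntidiagonal.mem_antidiagonal] at hp
    have h0 := DFunLike.congr_fun hp 0
    have h1 := DFunLike.congr_fun hp 1
    simp only [Finsupp.add_apply, monomialExp_zero, monomialExp_one] at h0 h1
    simp only [← h0, ← h1, Nat.add_sub_cancel_left, monomialExp_eq]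

theorem coeff_subst_C_mul_X (f : PowerSeries Coeff) (c : Coeff) (s : Fin 2) (e : Fin 2 →₀ ℕ) :
    MvPowerSeries.coeff e (f.subst (MvPowerSeries.C c * MvPowerSeries.X s : Series)) =
      if e = Finsupp.single s (e s) then c ^ e s * PowerSeries.coeff (e s) f else 0 := by
  have hpow : ∀ d : ℕ, MvPowerSeries.coeff e
      ((MvPowerSeries.C c * MvPowerSeries.X s : Series) ^ d) =
        if e = Finsupp.single s d then c ^ d else 0 := by
    intro d
    rw [mul_pow, ← map_pow, MvPowerSeries.coeff_C_mul, MvPowerSeries.coeff_X_pow]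
    simp
  rw [PowerSeries.coeff_subst (PowerSeries.HasSubst.of_constantCoeff_zero (by simp)),
    finsum_eq_single _ (e s)]
  · rw [hpow, smul_eq_mul, mul_ite, mul_zero, mul_comm]
  · intro d hd
    rw [hpow, if_neg, smul_zero]
    rintro h
    exact hd (by rw [h, Finsupp.single_eq_same])

theorem coeff_subst_X (f : PowerSeries Coeff) (s : Fin 2) (e : Fin 2 →₀ ℕ) :
    MvPowerSeries.coeff e (f.subst (MvPowerSeries.X s : Series)) =
      if e = Finsupp.single s (e s) then PowerSeries.coeff (e s) f else 0 := by
  have h := coeff_subst_C_mul_X f 1 s e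
  rwa [map_one, one_mul, one_pow, one_mul] at h

theorem expOf_C_mul_X (c : Coeff) (s : Fin 2) :
    expOf (MvPowerSeries.C c * MvPowerSeries.X s) =
      (PowerSeries.rescale c (PowerSeries.exp Coeff)).subst (MvPowerSeries.X s : Series) := by
  ext1 e
  rw [expOf, coeff_subst_C_mul_X, coeff_subst_X, PowerSeries.coeff_rescale]

theorem hasSubst_X (s : Fin 2) : PowerSeries.HasSubst (MvPowerSeries.X s : Series) :=
  PowerSeries.HasSubst.of_constantCoeff_zero (by simp)

theorem expOf_add (c d : Coeff) (s : Fin 2) :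
    expOf ((MvPowerSeries.C c + MvPowerSeries.C d) * MvPowerSeries.X s) =
      expOf (MvPowerSeries.C c * MvPowerSeries.X s) *
        expOf (MvPowerSeries.C d * MvPowerSeries.X s) := by
  rw [← map_add, expOf_C_mul_X, expOf_C_mul_X, expOf_C_mul_X,
    ← PowerSeries.subst_mul (hasSubst_X s), PowerSeries.exp_mul_exp_eq_exp_add]

theorem expOf_serα_mul_X (s : Fin 2) :
    expOf (serα * MvPowerSeries.X s) = 1 + serα * etaOf (MvPowerSeries.X s) := by
  ext1 e
  have hc := congrArg (PowerSeries.coeff (e s)) varα_mul_etaSeries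
  rw [PowerSeries.coeff_C_mul, map_sub, PowerSeries.coeff_one, eq_sub_iff_add_eq'] at hc
  rw [serα, expOf_C_mul_X, etaOf, map_add, MvPowerSeries.coeff_C_mul, coeff_subst_X,
    coeff_subst_X, ← hc, MvPowerSeries.coeff_one]
  by_cases he : e = Finsupp.single s (e s)
  · have h0 : e = 0 ↔ e s = 0 := by
      rw [he]
      simp
    simp [← he, h0]
  · have h0 : e ≠ 0 := by
      rintro rfl
      simp at he
    simp [he, h0]

theorem coeff_etaSeries (n : ℕ) :
    PowerSeries.coeff n etaSeries = algebraMap ℚ Coeff (1 / n.factorial) * etaCoeff n := by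
  rw [etaSeries, PowerSeries.coeff_mk, etaCoeff]
  split_ifs <;> simp

theorem coeff_X_add_Y_pow (k l d : ℕ) :
    MvPowerSeries.coeff (monomialExp k l) ((varX + varY) ^ d) =
      if k + l = d then (d.choose k : Coeff) else 0 := by
  have hmono : ∀ i j : ℕ, (varX ^ i * varY ^ j : Series) =
      MvPowerSeries.monomial (monomialExp i j) 1 := by
    intro i j
    rw [varX, varY, MvPowerSeries.X_pow_eq, MvPowerSeries.X_pow_eq,
      MvPowerSeries.monomial_mul_monomial, one_mul, monomialExp]
  have hinj : ∀ i j : ℕ, monomialExp k l = monomialExp i j ↔ k = i ∧ l = j := by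
    simp [Finsupp.ext_iff, Fin.forall_fin_two]
  simp only [add_pow, map_sum, hmono, ← map_natCast (MvPowerSeries.C (σ := Fin 2) (R := Coeff)),
    MvPowerSeries.coeff_mul_C, MvPowerSeries.coeff_monomial, hinj]
  split_ifs with h
  · rw [Finset.sum_eq_single k]
    · rw [if_pos ⟨rfl, by omega⟩, one_mul]
    · intro i _ hi
      rw [if_neg fun h => hi h.1.symm, zero_mul]
    · intro hk
      exact absurd (Finset.mem_range.2 (by omega)) hk
  · refine Finset.sum_eq_zero fun i hi => ?_
    rw [Finset.mem_range] at hi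
    rw [if_neg (by omega), zero_mul]

/-- The number `k! l!` times the coefficient of `xᵏ yˡ`. -/
noncomputable def egfCoeff (k l : ℕ) (F : Series) : Coeff :=
  (k.factorial * l.factorial : ℕ) * MvPowerSeries.coeff (monomialExp k l) F

theorem factorial_mul_algebraMap (n : ℕ) :
    (n.factorial : Coeff) * algebraMap ℚ Coeff (1 / n.factorial) = 1 := by
  rw [← map_natCast (algebraMap ℚ Coeff), ← map_mul, mul_one_div_cancel, map_one]
  exact_mod_cast n.factorial_ne_zero

theorem egfCoeff_etaOf_add (k l : ℕ) : egfCoeff k l (etaOf (varX + varY)) = etaCoeff (k + l) := by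
  rw [egfCoeff, etaOf, PowerSeries.coeff_subst
    (PowerSeries.HasSubst.of_constantCoeff_zero (by simp [varX, varY])),
    finsum_eq_single _ (k + l)]
  · rw [coeff_X_add_Y_pow, if_pos rfl, coeff_etaSeries, smul_eq_mul]
    have h := Nat.add_choose_mul_factorial_mul_factorial k l
    calc _ = (((k + l).choose k * k.factorial * l.factorial : ℕ) : Coeff) *
          algebraMap ℚ Coeff (1 / (k + l).factorial) * etaCoeff (k + l) := by
            push_cast
            ring
      _ = _ := by rw [Nat.choose_symm_add, h, factorial_mul_algebraMap, one_mul]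
  · intro d hd
    rw [coeff_X_add_Y_pow, if_neg (Ne.symm hd), smul_zero]

theorem egfCoeff_mul (F G : Series) (k l : ℕ) :
    egfCoeff k l (F * G) = ∑ i ∈ Finset.range (k + 1), ∑ j ∈ Finset.range (l + 1),
      (k.choose i * l.choose j : ℕ) * (egfCoeff i j F * egfCoeff (k - i) (l - j) G) := by
  rw [egfCoeff, coeff_mul_monomialExp, Finset.mul_sum]
  refine Finset.sum_congr rfl fun i hi => ?_
  rw [Finset.mul_sum]
  refine Finset.sum_congr rfl fun j hj => ?_
  rw [Finset.mem_range, Nat.lt_succ_iff] at hi hj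
  rw [egfCoeff, egfCoeff, ← Nat.choose_mul_factorial_mul_factorial hi,
    ← Nat.choose_mul_factorial_mul_factorial hj]
  push_cast
  ring

theorem egfCoeff_subst_X (f : PowerSeries Coeff) (k l : ℕ) :
    egfCoeff k l (f.subst varX) =
      if l = 0 then k.factorial * PowerSeries.coeff k f else 0 := by
  rw [egfCoeff, varX, coeff_subst_X, monomialExp_zero]
  simp only [monomialExp_eq_single_zero, true_and]
  split_ifs with h <;> simp [h]

theorem egfCoeff_subst_Y (f : PowerSeries Coeff) (k l : ℕ) :
    egfCoeff k l (f.subst varY) =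
      if k = 0 then l.factorial * PowerSeries.coeff l f else 0 := by
  rw [egfCoeff, varY, coeff_subst_X, monomialExp_one]
  simp only [monomialExp_eq_single_one, and_true]
  split_ifs with h <;> simp [h]

theorem factorial_mul_coeff_etaSeries (n : ℕ) :
    n.factorial * PowerSeries.coeff n etaSeries = etaCoeff n := by
  rw [coeff_etaSeries, ← mul_assoc, factorial_mul_algebraMap, one_mul]

theorem factorial_mul_coeff_rescale_exp (c : Coeff) (n : ℕ) :
    n.factorial * PowerSeries.coeff n (PowerSeries.rescale c (PowerSeries.exp Coeff)) = c ^ n := by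
  rw [PowerSeries.coeff_rescale, PowerSeries.coeff_exp, mul_left_comm, factorial_mul_algebraMap,
    mul_one]

theorem egfCoeff_add (k l : ℕ) (F G : Series) :
    egfCoeff k l (F + G) = egfCoeff k l F + egfCoeff k l G := by
  rw [egfCoeff, map_add, mul_add, egfCoeff, egfCoeff]

theorem egfCoeff_sub (k l : ℕ) (F G : Series) :
    egfCoeff k l (F - G) = egfCoeff k l F - egfCoeff k l G := by
  rw [egfCoeff, map_sub, mul_sub, egfCoeff, egfCoeff]

theorem egfCoeff_C_mul (k l : ℕ) (c : Coeff) (F : Series) :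
    egfCoeff k l (MvPowerSeries.C c * F) = c * egfCoeff k l F := by
  rw [egfCoeff, MvPowerSeries.coeff_C_mul, egfCoeff, mul_left_comm]

theorem egfCoeff_one (k l : ℕ) : egfCoeff k l 1 = if k = 0 ∧ l = 0 then 1 else 0 := by
  have h : monomialExp k l = 0 ↔ k = 0 ∧ l = 0 := by
    simp [Finsupp.ext_iff, Fin.forall_fin_two]
  rw [egfCoeff, MvPowerSeries.coeff_one]
  simp only [h]
  split_ifs with h <;> simp [h]

theorem ext_egfCoeff {F G : Series} (h : ∀ k l, egfCoeff k l F = egfCoeff k l G) : F = G := by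
  ext1 e
  have he := h (e 0) (e 1)
  rw [egfCoeff, egfCoeff, monomialExp_eq] at he
  refine mul_left_cancel₀ ?_ he
  exact_mod_cast (Nat.mul_pos (Nat.factorial_pos _) (Nat.factorial_pos _)).ne'

/-- The functional equation of `η`, reflecting `e ^ (α (x + y)) = e ^ (α x) * e ^ (α y)`. -/
theorem etaOf_add : etaOf (varX + varY) =
    etaOf varX + etaOf varY + serα * (etaOf varX * etaOf varY) := by
  refine ext_egfCoeff fun k l => ?_
  have hprod : egfCoeff k l (etaOf varX * etaOf varY) = etaCoeff k * etaCoeff l := by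
    rw [egfCoeff_mul, Finset.sum_eq_single k, Finset.sum_eq_single 0]
    · simp only [etaOf, egfCoeff_subst_X, egfCoeff_subst_Y, factorial_mul_coeff_etaSeries]
      simp
    · intro j _ hj
      rw [etaOf, egfCoeff_subst_X, if_neg hj, zero_mul, mul_zero]
    · simp
    · intro i hi hik
      refine Finset.sum_eq_zero fun j _ => ?_
      rw [Finset.mem_range] at hi
      rw [etaOf, etaOf, egfCoeff_subst_Y, if_neg (by omega), mul_zero, mul_zero]
    · simp
  rw [egfCoeff_etaOf_add, egfCoeff_add, egfCoeff_add, serα, egfCoeff_C_mul, hprod, etaOf, etaOf,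
    egfCoeff_subst_X, egfCoeff_subst_Y, factorial_mul_coeff_etaSeries,
    factorial_mul_coeff_etaSeries]
  rcases k with _ | k <;> rcases l with _ | l
  · simp [etaCoeff]
  · simp [etaCoeff]
  · simp [etaCoeff]
  · simp [etaCoeff, show k + 1 + (l + 1) - 1 = k + l + 1 by omega]
    ring

/-- The asserted generating function without its linear terms `x + y`, hence the one over the
pairs `k, l ≥ 1`. -/
noncomputable def mixedSeries : Series :=
  invOneSub *
    (expOf ((serα + serT) * varX) * etaOf varY + expOf ((serα + serT) * varY) * etaOf varX
      + serα * etaOf varX * etaOf varY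
      - expOf (serα * varX) * etaOf varY - expOf (serα * varY) * etaOf varX)

/-- The exponential generating function of `typeSum`: it is `t` times that of the f-polynomials
for `k, l ≥ 1`, together with the terms `tᵏ xᵏ / k!` and `tˡ yˡ / l!` of the graphs without
edges. -/
noncomputable def typeSeries : Series :=
  serT * mixedSeries + expOf (serT * varX) + expOf (serT * varY) - 1

theorem mixedSeries_eq :
    mixedSeries = invOneSub *
      ((1 + serα * etaOf varX) * expOf (serT * varX) * etaOf varY +
        (1 + serα * etaOf varY) * expOf (serT * varY) * etaOf varX - etaOf (varX + varY)) := by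
  rw [mixedSeries, etaOf_add, varX, varY]
  have h : ∀ s, expOf ((serα + serT) * MvPowerSeries.X s) =
      expOf (serα * MvPowerSeries.X s) * expOf (serT * MvPowerSeries.X s) :=
    fun s => expOf_add varα varT s
  simp only [h, expOf_serα_mul_X]
  ring

/-- The recursion of `typeSum` for series. The summand that is added to `t η(x + y) G` is a series
in `x` plus a series in `y`, so it has no mixed terms. -/
theorem typeSeries_eq :
    typeSeries = serT * (etaOf (varX + varY) * typeSeries) +
      ((expOf (serT * varX) - serT * (etaOf varX * expOf (serT * varX))) +
        (expOf (serT * varY) - serT * (etaOf varY * expOf (serT * varY))) - 1) := by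
  have h : (1 - serT * etaOf (varX + varY)) * mixedSeries =
      (1 + serα * etaOf varX) * expOf (serT * varX) * etaOf varY +
        (1 + serα * etaOf varY) * expOf (serT * varY) * etaOf varX - etaOf (varX + varY) := by
    rw [mixedSeries_eq, ← mul_assoc, one_sub_mul_invOneSub, one_mul]
  rw [typeSeries]
  rw [etaOf_add] at h ⊢
  linear_combination serT * h

theorem expOf_serT_mul_varX : expOf (serT * varX) =
    (PowerSeries.rescale varT (PowerSeries.exp Coeff)).subst varX :=
  expOf_C_mul_X varT 0

theorem expOf_serT_mul_varY : expOf (serT * varY) =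
    (PowerSeries.rescale varT (PowerSeries.exp Coeff)).subst varY :=
  expOf_C_mul_X varT 1

theorem egfCoeff_typeSeries_of_pos {k l : ℕ} (hk : 0 < k) (hl : 0 < l) :
    egfCoeff k l typeSeries =
      ∑ i ∈ Finset.range (k + 1), ∑ j ∈ Finset.range (l + 1),
        (k.choose i * l.choose j : ℕ) *
          (etaCoeff (i + j) * (varT * egfCoeff (k - i) (l - j) typeSeries)) := by
  have hX : etaOf varX * expOf (serT * varX) =
      (etaSeries * PowerSeries.rescale varT (PowerSeries.exp Coeff)).subst varX := by
    rw [expOf_serT_mul_varX, etaOf, varX, ← PowerSeries.subst_mul (hasSubst_X 0)]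
  have hY : etaOf varY * expOf (serT * varY) =
      (etaSeries * PowerSeries.rescale varT (PowerSeries.exp Coeff)).subst varY := by
    rw [expOf_serT_mul_varY, etaOf, varY, ← PowerSeries.subst_mul (hasSubst_X 1)]
  conv_lhs => rw [typeSeries_eq]
  rw [hX, hY, expOf_serT_mul_varX, expOf_serT_mul_varY, serT]
  simp only [egfCoeff_add, egfCoeff_sub, egfCoeff_C_mul, egfCoeff_subst_X, egfCoeff_subst_Y,
    egfCoeff_one, hk.ne', hl.ne', false_and, if_false, mul_zero, sub_zero, add_zero]
  rw [egfCoeff_mul, Finset.mul_sum]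
  refine Finset.sum_congr rfl fun i _ => ?_
  rw [Finset.mul_sum]
  refine Finset.sum_congr rfl fun j _ => ?_
  rw [egfCoeff_etaOf_add]
  ring

theorem X_dvd_etaOf (s : Fin 2) : (MvPowerSeries.X s : Series) ∣ etaOf (MvPowerSeries.X s) := by
  refine MvPowerSeries.X_dvd_iff.2 fun e he => ?_
  rw [etaOf, coeff_subst_X, he]
  simp [etaSeries]

theorem X_dvd_expOf_sub_one (s : Fin 2) :
    (MvPowerSeries.X s : Series) ∣ expOf (serT * MvPowerSeries.X s) - 1 := by
  refine MvPowerSeries.X_dvd_iff.2 fun e he => ?_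
  rw [serT, expOf_C_mul_X, map_sub, coeff_subst_X, he, MvPowerSeries.coeff_one]
  simp

theorem varX_dvd_mixedSeries : varX ∣ mixedSeries := by
  rw [mixedSeries_eq, etaOf_add]
  refine Dvd.dvd.mul_left ?_ _
  obtain ⟨u, hu⟩ : varX ∣ etaOf varX := X_dvd_etaOf 0
  obtain ⟨v, hv⟩ : varX ∣ expOf (serT * varX) - 1 := X_dvd_expOf_sub_one 0
  rw [sub_eq_iff_eq_add] at hv
  rw [hu, hv]
  refine ⟨v * etaOf varY + serα * u * (varX * v + 1) * etaOf varY +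
    (1 + serα * etaOf varY) * expOf (serT * varY) * u - u - serα * u * etaOf varY, ?_⟩
  ring

theorem varY_dvd_mixedSeries : varY ∣ mixedSeries := by
  rw [mixedSeries_eq, etaOf_add]
  refine Dvd.dvd.mul_left ?_ _
  obtain ⟨u, hu⟩ : varY ∣ etaOf varY := X_dvd_etaOf 1
  obtain ⟨v, hv⟩ : varY ∣ expOf (serT * varY) - 1 := X_dvd_expOf_sub_one 1
  rw [sub_eq_iff_eq_add] at hv
  rw [hu, hv]
  refine ⟨v * etaOf varX + serα * u * (varY * v + 1) * etaOf varX +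
    (1 + serα * etaOf varX) * expOf (serT * varX) * u - u - serα * u * etaOf varX, ?_⟩
  ring

theorem coeff_mixedSeries_eq_zero {e : Fin 2 →₀ ℕ} (he : e 0 = 0 ∨ e 1 = 0) :
    MvPowerSeries.coeff e mixedSeries = 0 :=
  he.elim (MvPowerSeries.X_dvd_iff.1 varX_dvd_mixedSeries e)
    (MvPowerSeries.X_dvd_iff.1 varY_dvd_mixedSeries e)

theorem egfCoeff_typeSeries_eq (k l : ℕ) :
    egfCoeff k l typeSeries = varT * egfCoeff k l mixedSeries +
      (if l = 0 then varT ^ k else 0) + (if k = 0 then varT ^ l else 0) -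
        if k = 0 ∧ l = 0 then 1 else 0 := by
  rw [typeSeries, expOf_serT_mul_varX, expOf_serT_mul_varY, serT, egfCoeff_sub, egfCoeff_add,
    egfCoeff_add, egfCoeff_C_mul, egfCoeff_subst_X, egfCoeff_subst_Y, egfCoeff_one]
  simp only [factorial_mul_coeff_rescale_exp]

theorem egfCoeff_typeSeries_of_eq_zero {k l : ℕ} (h : k = 0 ∨ l = 0) :
    egfCoeff k l typeSeries = varT ^ (k + l) := by
  have h0 : egfCoeff k l mixedSeries = 0 := by
    rw [egfCoeff, coeff_mixedSeries_eq_zero (by simpa using h), mul_zero]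
  rw [egfCoeff_typeSeries_eq, h0]
  rcases h with rfl | rfl
  · by_cases hl : l = 0 <;> simp [hl]
  · by_cases hk : k = 0 <;> simp [hk]

end Series

/-! ### Complete bipartite graphs -/

section Bipartite

variable {α β : Type*}

theorem sum_powerset_sum {M : Type*} [AddCommMonoid M] [DecidableEq α] [DecidableEq β]
    (U : Finset (α ⊕ β)) (F : ℕ → ℕ → M) :
    ∑ A ∈ U.powerset, F A.toLeft.card A.toRight.card =
      ∑ i ∈ Finset.range (U.toLeft.card + 1), ∑ j ∈ Finset.range (U.toRight.card + 1),
        (U.toLeft.card.choose i * U.toRight.card.choose j) • F i j := by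
  have h : ∑ A ∈ U.powerset, F A.toLeft.card A.toRight.card =
      ∑ L ∈ U.toLeft.powerset, ∑ R ∈ U.toRight.powerset, F L.card R.card := by
    rw [← Finset.sum_product']
    refine Finset.sum_bij' (fun A _ => (A.toLeft, A.toRight)) (fun p _ => p.1.disjSum p.2)
      ?_ ?_ (fun _ _ => Finset.toLeft_disjSum_toRight) ?_ ?_
    · intro A hA
      rw [Finset.mem_powerset] at hA
      simp [Finset.toLeft_subset_toLeft hA, Finset.toRight_subset_toRight hA]
    · rintro ⟨L, R⟩ hp
      simp only [Finset.mem_product, Finset.mem_powerset] at hp ⊢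
      rw [← Finset.toLeft_disjSum_toRight (u := U)]
      exact Finset.disjSum_mono hp.1 hp.2
    · simp
    · simp
  have hR : ∀ n, ∑ R ∈ U.toRight.powerset, F n R.card =
      ∑ j ∈ Finset.range (U.toRight.card + 1), U.toRight.card.choose j • F n j :=
    fun n => Finset.sum_powerset_apply_card (F n)
  rw [h]
  simp only [hR]
  rw [Finset.sum_powerset_apply_card fun n => ∑ j ∈ Finset.range (U.toRight.card + 1),
    U.toRight.card.choose j • F n j]
  simp only [Finset.smul_sum, mul_smul]

variable [Fintype α] [Fintype β] [DecidableEq α] [DecidableEq β]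

theorem mem_graphicalBuildingSet {V : Type*} [Fintype V] [DecidableEq V] {Γ : SimpleGraph V}
    {S : Finset V} :
    S ∈ (graphicalBuildingSet Γ).sets ↔ (Γ.induce (S : Set V)).Connected := by
  simp [graphicalBuildingSet]

theorem univ_mem_graphicalBuildingSet {V : Type*} [Fintype V] [DecidableEq V]
    {Γ : SimpleGraph V} : Finset.univ ∈ (graphicalBuildingSet Γ).sets ↔ Γ.Connected := by
  rw [mem_graphicalBuildingSet, Finset.coe_univ]
  exact (SimpleGraph.induceUnivIso Γ).connected_iff

theorem mem_bipartiteBuildingSet_of_nonempty {S : Finset (α ⊕ β)} (hL : S.toLeft.Nonempty)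
    (hR : S.toRight.Nonempty) :
    S ∈ (graphicalBuildingSet (completeBipartiteGraph α β)).sets := by
  rw [mem_graphicalBuildingSet]
  obtain ⟨a, ha⟩ := hL
  obtain ⟨b, hb⟩ := hR
  rw [Finset.mem_toLeft] at ha
  rw [Finset.mem_toRight] at hb
  set G := (completeBipartiteGraph α β).induce (S : Set (α ⊕ β))
  have hadj : ∀ (a' : α) (b' : β) (ha' : Sum.inl a' ∈ S) (hb' : Sum.inr b' ∈ S),
      G.Adj ⟨Sum.inl a', ha'⟩ ⟨Sum.inr b', hb'⟩ := by
    intro a' b' ha' hb'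
    simp [G]
  have hreach : ∀ v, G.Reachable ⟨Sum.inl a, ha⟩ v := by
    rintro ⟨a' | b', hv⟩
    · exact (hadj a b ha hb).reachable.trans (hadj a' b hv hb).reachable.symm
    · exact (hadj a b' ha hv).reachable
  have : Nonempty (S : Set (α ⊕ β)) := ⟨⟨Sum.inl a, ha⟩⟩
  exact ⟨fun u v => (hreach u).symm.trans (hreach v)⟩

theorem card_eq_one_of_mem_bipartiteBuildingSet {S : Finset (α ⊕ β)}
    (hS : S ∈ (graphicalBuildingSet (completeBipartiteGraph α β)).sets)
    (h : S.toLeft = ∅ ∨ S.toRight = ∅) : S.card = 1 := by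
  rw [mem_graphicalBuildingSet] at hS
  have hbot : (completeBipartiteGraph α β).induce (S : Set (α ⊕ β)) = ⊥ := by
    ext ⟨u, hu⟩ ⟨v, hv⟩
    rw [Finset.mem_coe] at hu hv
    simp only [Finset.eq_empty_iff_forall_notMem, Finset.mem_toLeft, Finset.mem_toRight] at h
    rcases u with a | b <;> rcases v with a' | b' <;> simp <;> grind
  obtain ⟨v⟩ := hS.nonempty
  refine Finset.card_eq_one.2 ⟨v, ?_⟩
  refine Finset.eq_singleton_iff_unique_mem.2 ⟨v.2, fun u hu => ?_⟩
  have huv := hS.preconnected ⟨u, hu⟩ v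
  rw [hbot, SimpleGraph.reachable_bot] at huv
  exact congrArg Subtype.val huv

theorem typeSum_bipartite (U : Finset (α ⊕ β)) :
    typeSum (graphicalBuildingSet (completeBipartiteGraph α β)) U =
      egfCoeff U.toLeft.card U.toRight.card typeSeries := by
  induction U using Finset.strongInduction with
  | H U ih =>
    by_cases h : U.toLeft = ∅ ∨ U.toRight = ∅
    · rw [typeSum_of_card_eq_one, egfCoeff_typeSeries_of_eq_zero (by simpa using h),
        Finset.card_toLeft_add_card_toRight]
      intro S hS hSU
      refine card_eq_one_of_mem_bipartiteBuildingSet hS (h.imp (fun h => ?_) fun h => ?_)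
      · exact Finset.subset_empty.1 (h ▸ Finset.toLeft_subset_toLeft hSU)
      · exact Finset.subset_empty.1 (h ▸ Finset.toRight_subset_toRight hSU)
    · rw [not_or, ← Ne, ← Ne, ← Finset.nonempty_iff_ne_empty, ← Finset.nonempty_iff_ne_empty] at h
      rw [typeSum_eq_sum_powerset (mem_bipartiteBuildingSet_of_nonempty h.1 h.2),
        egfCoeff_typeSeries_of_pos h.1.card_pos h.2.card_pos]
      have hterm : ∀ A ∈ U.powerset, etaCoeff A.card *
          (varT * typeSum (graphicalBuildingSet (completeBipartiteGraph α β)) (U \ A)) =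
          etaCoeff (A.toLeft.card + A.toRight.card) * (varT * egfCoeff
            (U.toLeft.card - A.toLeft.card) (U.toRight.card - A.toRight.card) typeSeries) := by
        intro A hA
        rw [Finset.mem_powerset] at hA
        rw [Finset.card_toLeft_add_card_toRight]
        rcases A.eq_empty_or_nonempty with rfl | hne
        · simp [etaCoeff]
        · rw [ih _ (Finset.sdiff_ssubset hA hne), Finset.toLeft_sdiff, Finset.toRight_sdiff,
            Finset.card_sdiff_of_subset (Finset.toLeft_subset_toLeft hA),
            Finset.card_sdiff_of_subset (Finset.toRight_subset_toRight hA)]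
      rw [Finset.sum_congr rfl hterm, sum_powerset_sum U fun i j => etaCoeff (i + j) *
        (varT * egfCoeff (U.toLeft.card - i) (U.toRight.card - j) typeSeries)]
      simp only [nsmul_eq_mul]

theorem completeBipartiteGraph_connected_iff {k l : ℕ} :
    (completeBipartiteGraph (Fin k) (Fin l)).Connected ↔ (0 < k ∧ 0 < l) ∨ k + l = 1 := by
  rw [← univ_mem_graphicalBuildingSet]
  constructor
  · intro h
    by_cases h0 : k = 0 ∨ l = 0
    · right
      have := card_eq_one_of_mem_bipartiteBuildingSet h
        (h0.imp (fun h => by subst h; exact Finset.eq_empty_of_isEmpty _)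
          fun h => by subst h; exact Finset.eq_empty_of_isEmpty _)
      simpa using this
    · omega
  · rintro (⟨hk, hl⟩ | h)
    · exact mem_bipartiteBuildingSet_of_nonempty ⟨⟨0, hk⟩, by simp⟩ ⟨⟨0, hl⟩, by simp⟩
    · have hcard : (Finset.univ : Finset (Fin k ⊕ Fin l)).card = 1 := by simpa using h
      obtain ⟨v, hv⟩ := Finset.card_eq_one.1 hcard
      rw [hv]
      exact (graphicalBuildingSet _).singleton_mem v

theorem varT_mul_fPolynomial {k l : ℕ}
    (h : (completeBipartiteGraph (Fin k) (Fin l)).Connected) :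
    varT * fPolynomial (bipartiteNestohedron k l) = egfCoeff k l typeSeries := by
  rw [bipartiteNestohedron,
    varT_mul_fPolynomial_nestohedron (univ_mem_graphicalBuildingSet.2 h), typeSum_bipartite]
  congr 1 <;> simp

theorem varT_ne_zero : varT ≠ 0 := MvPolynomial.X_ne_zero 1

theorem fPolynomial_of_pos {k l : ℕ} (hk : 0 < k) (hl : 0 < l) :
    fPolynomial (bipartiteNestohedron k l) = egfCoeff k l mixedSeries := by
  refine mul_left_cancel₀ varT_ne_zero ?_
  rw [varT_mul_fPolynomial (completeBipartiteGraph_connected_iff.2 (Or.inl ⟨hk, hl⟩)),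
    egfCoeff_typeSeries_eq]
  simp [hk.ne', hl.ne']

theorem fPolynomial_of_add_eq_one {k l : ℕ} (h : k + l = 1) :
    fPolynomial (bipartiteNestohedron k l) = 1 := by
  refine mul_left_cancel₀ varT_ne_zero ?_
  rw [varT_mul_fPolynomial (completeBipartiteGraph_connected_iff.2 (Or.inr h)),
    egfCoeff_typeSeries_of_eq_zero (by omega), h, pow_one, mul_one]

theorem egfCoeff_X_add_Y (k l : ℕ) :
    egfCoeff k l (varX + varY) = if k + l = 1 then 1 else 0 := by
  have h := coeff_X_add_Y_pow k l 1
  rw [pow_one] at h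
  rw [egfCoeff, h]
  split_ifs with hkl
  · obtain ⟨rfl, rfl⟩ | ⟨rfl, rfl⟩ := Nat.add_eq_one_iff.1 hkl <;> simp
  · rw [mul_zero]

theorem egfCoeff_bipartiteFSeries {k l : ℕ}
    (h : (completeBipartiteGraph (Fin k) (Fin l)).Connected) :
    egfCoeff k l bipartiteFSeries = fPolynomial (bipartiteNestohedron k l) := by
  have hcoeff : MvPowerSeries.coeff (monomialExp k l) bipartiteFSeries =
      algebraMap ℚ Coeff (1 / (k.factorial * l.factorial : ℚ)) *
        fPolynomial (bipartiteNestohedron k l) := by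
    rw [MvPowerSeries.coeff_apply, bipartiteFSeries]
    rw [if_pos (by rwa [monomialExp_zero, monomialExp_one]), monomialExp_zero, monomialExp_one]
  have hne : (k.factorial * l.factorial : ℚ) ≠ 0 := by positivity
  rw [egfCoeff, hcoeff, ← mul_assoc, ← map_natCast (algebraMap ℚ Coeff), ← map_mul,
    Nat.cast_mul, mul_one_div_cancel hne, map_one, one_mul]

theorem egfCoeff_bipartiteFSeries_eq_zero {k l : ℕ}
    (h : ¬ (completeBipartiteGraph (Fin k) (Fin l)).Connected) :
    egfCoeff k l bipartiteFSeries = 0 := by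
  rw [egfCoeff, MvPowerSeries.coeff_apply, bipartiteFSeries]
  rw [if_neg (by rwa [monomialExp_zero, monomialExp_one]), mul_zero]

theorem bipartiteFSeries_eq : bipartiteFSeries = mixedSeries + (varX + varY) := by
  refine ext_egfCoeff fun k l => ?_
  rw [egfCoeff_add]
  have hconn := completeBipartiteGraph_connected_iff (k := k) (l := l)
  by_cases h : 0 < k ∧ 0 < l
  · rw [egfCoeff_bipartiteFSeries (hconn.2 (Or.inl h)), fPolynomial_of_pos h.1 h.2,
      egfCoeff_X_add_Y, if_neg (by omega), add_zero]
  · have h0 : egfCoeff k l mixedSeries = 0 := by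
      rw [egfCoeff, coeff_mixedSeries_eq_zero, mul_zero]
      simp only [monomialExp_zero, monomialExp_one]
      omega
    rw [h0, zero_add, egfCoeff_X_add_Y]
    split_ifs with h1
    · rw [egfCoeff_bipartiteFSeries (hconn.2 (Or.inr h1)), fPolynomial_of_add_eq_one h1]
    · exact egfCoeff_bipartiteFSeries_eq_zero (mt hconn.1 (not_or.2 ⟨h, h1⟩))

end Bipartite

end BipartiteNestohedra

open BipartiteNestohedra in
theorem mainTheorem2 :
    bipartiteFSeries =
      invOneSub *
        (expOf ((serα + serT) * varX) * etaOf varY + expOf ((serα + serT) * varY) * etaOf varX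
          + serα * etaOf varX * etaOf varY
          - expOf (serα * varX) * etaOf varY - expOf (serα * varY) * etaOf varX)
        + (varX + varY) := by
  exact bipartiteFSeries_eq
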